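/- Let $k$ be an algebraically closed field, let $n\ge 0$, and let $M_1,\dots,M_n$ be finitely generated abelian groups. Then there exist a triangular $k$-algebra $A$, with finite connected quiver $Q_A$ without oriented cycles, and presentations $\nu_i : kQ_A \to A$ with kernels $I_i$ (so that $A\cong kQ_A/I_i$), $i=1,\dots,n$, such that $$\pi_1(Q_A,I_i)\cong M_i\qquad\text{for all } i\in\{1,\dots,n\}.$$ Here the following terminology is used. For a finite connected quiver $Q$, $kQ$ is the path algebra (basis: all paths, including a stationary path $e_x$ for each vertex $x$; product: composition, or $0$ if it is not defined) and $F\subseteq kQ$ is the two-sided ideal generated by the arrows. A two-sided ideal $I$ is admissible if $F^m\subseteq I\subseteq F^2$ for some $m\ge 2$. A presentation of $A$ is a surjective morphism of $k$-algebras $\nu: kQ\to A$ whose kernel is admissible; if one exists, then $A$ is finite dimensional, basic and connected, and $Q=Q_A$ is determined by $A$ up to isomorphism. The algebra $A$ is triangular if $Q_A$ has no oriented cycles. A minimal relation of $I$ is an element $\sum_{j=1}^m\lambda_j w_j$ of $I$, where $m\ge2$, the $w_j$ are pairwise distinct paths with a common source and a common target, and $\lambda_j\in k\setminus\{0\}$,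 such that $\sum_{j\in J}\lambda_j w_j\notin I$ for every nonempty proper subset $J\subset\{1,\dots,m\}$. A walk is a composable sequence of arrows and formal inverses of arrows, and homotopy $\sim$ is the smallest equivalence relation on walks such that $\alpha\alpha^{-1}\sim e_x$ and $\alpha^{-1}\alpha\sim e_y$ for every arrow $\alpha:x\to y$; $w_i\sim w_j$ for all $i,j$ whenever $\sum_j\lambda_j w_j$ is a minimal relation of $I$; and $wuw'\sim wvw'$ whenever $u\sim v$ and these compositions are defined. Finally, $\pi_1(Q,I)=\pi_1(Q,I,x)$ is the group of homotopy classes of closed walks at a vertex $x$; as $Q$ is connected, it does not depend on $x$ up to isomorphism. -/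

import Mathlib

/-! # Bound quivers, presentations of algebras and their fundamental groups -/

universe u v w

namespace BoundQuiver

open Quiver

noncomputable section

/-! ## Quivers

Quivers are Mathlib's: `V` is the set of vertices, `x ⟶ y` the set of arrows from `x` to `y`,
and `Quiver.Path x y` the set of paths, composed from left to right. -/

/-- A walk from `x` to `y`: a composable sequence of arrows and formal inverses of arrows. -/
abbrev Walk (V : Type v) [Quiver.{w} V] (x y : Symmetrify V) : Type (max v w) :=
  Path x y

/-- The quiver is nonempty and its underlying graph is connected. -/
def IsConnectedQuiver (V : Type v) [Quiver.{w} V] : Prop :=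
  Nonempty V ∧ ∀ x y : V, Nonempty (Walk V x y)

/-- The quiver has no oriented cycles: every closed path is stationary. -/
def IsAcyclicQuiver (V : Type v) [Quiver.{w} V] : Prop :=
  ∀ (x : V) (p : Path x x), p = Path.nil

/-- An arrow, viewed as a walk of length one. -/
def arrowWalk {V : Type v} [Quiver.{w} V] {x y : V} (a : x ⟶ y) : Walk V x y :=
  @Hom.toPath (Symmetrify V) _ x y (Sum.inl a)

/-- The formal inverse of an arrow, viewed as a walk of length one. -/
def invArrowWalk {V : Type v} [Quiver.{w} V] {x y : V} (a : x ⟶ y) : Walk V y x :=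
  @Hom.toPath (Symmetrify V) _ y x (Sum.inr a)

/-- A path, viewed as a walk. -/
def pathWalk {V : Type v} [Quiver.{w} V] {x y : V} (p : Path x y) : Walk V x y :=
  (Symmetrify.of (V := V)).mapPath p

/-! ## The path algebra -/

/-- The path algebra `kQ`: the `k`-vector space with basis all paths of the quiver. -/
def PathAlgebra (k : Type u) (V : Type v) [Quiver.{w} V] [Field k] : Type (max u v w) :=
  (Σ x : V, Σ y : V, Path x y) →₀ k

namespace PathAlgebra

variable {k : Type u} {V : Type v} [Quiver.{w} V] [Field k]

instance : AddCommGroup (PathAlgebra k V) :=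
  inferInstanceAs (AddCommGroup ((Σ x : V, Σ y : V, Path x y) →₀ k))

instance : Module k (PathAlgebra k V) :=
  inferInstanceAs (Module k ((Σ x : V, Σ y : V, Path x y) →₀ k))

/-- The basis of `kQ` formed by all paths. -/
def pathBasis (k : Type u) (V : Type v) [Quiver.{w} V] [Field k] :
    Module.Basis (Σ x : V, Σ y : V, Path x y) k (PathAlgebra k V) :=
  Module.Basis.ofRepr (LinearEquiv.refl k ((Σ x : V, Σ y : V, Path x y) →₀ k))

/-- The basis element of `kQ` given by a path. -/
def ofPath (k : Type u) {V : Type v} [Quiver.{w} V] [Field k] {x y : V} (p : Path x y) :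
    PathAlgebra k V :=
  pathBasis k V ⟨x, y, p⟩

open Classical in
/-- The product of two basis elements: the composite path if it is defined, `0` otherwise. -/
def basisMul (k : Type u) {V : Type v} [Quiver.{w} V] [Field k]
    (p q : Σ x : V, Σ y : V, Path x y) : PathAlgebra k V :=
  if h : q.1 = p.2.1 then ofPath k (p.2.2.comp (q.2.2.cast h rfl)) else 0

/-- The bilinear extension of `basisMul`. -/
def mulLinear (k : Type u) (V : Type v) [Quiver.{w} V] [Field k] :
    PathAlgebra k V →ₗ[k] PathAlgebra k V →ₗ[k] PathAlgebra k V :=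
  (pathBasis k V).constr k fun p => (pathBasis k V).constr k (basisMul k p)

theorem basisMul_comp {x y z : V} (p : Path x y) (q : Path y z) :
    basisMul k ⟨x, y, p⟩ ⟨y, z, q⟩ = ofPath k (p.comp q) := by
  simp [basisMul]

theorem basisMul_of_ne {x y y' z : V} (p : Path x y) (q : Path y' z) (h : y' ≠ y) :
    basisMul k ⟨x, y, p⟩ ⟨y', z, q⟩ = 0 := by
  simp [basisMul, h]

theorem mulLinear_ofPath {x y y' z : V} (p : Path x y) (q : Path y' z) :
    mulLinear k V (ofPath k p) (ofPath k q) = basisMul k ⟨x, y, p⟩ ⟨y', z, q⟩ := by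
  simp only [mulLinear, ofPath, Module.Basis.constr_basis]

/-- Linear maps out of `kQ` that agree on all paths are equal. -/
theorem linearMap_ext {N : Type*} [AddCommGroup N] [Module k N]
    {f g : PathAlgebra k V →ₗ[k] N}
    (h : ∀ (x y : V) (p : Path x y), f (ofPath k p) = g (ofPath k p)) : f = g := by
  refine (pathBasis k V).ext ?_
  rintro ⟨x, y, p⟩
  exact h x y p

instance : Mul (PathAlgebra k V) := ⟨fun a b => mulLinear k V a b⟩

theorem mul_def (a b : PathAlgebra k V) : a * b = mulLinear k V a b := rfl

theorem ofPath_mul_ofPath {x y z : V} (p : Path x y) (q : Path y z) :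
    ofPath k p * ofPath k q = ofPath k (p.comp q) := by
  rw [mul_def, mulLinear_ofPath, basisMul_comp]

theorem ofPath_mul_ofPath_of_ne {x y y' z : V} (p : Path x y) (q : Path y' z) (h : y' ≠ y) :
    ofPath k p * ofPath k q = 0 := by
  rw [mul_def, mulLinear_ofPath, basisMul_of_ne p q h]

theorem ofPath_mul_assoc {x y x' y' x'' y'' : V} (p : Path x y) (q : Path x' y')
    (r : Path x'' y'') :
    ofPath k p * ofPath k q * ofPath k r = ofPath k p * (ofPath k q * ofPath k r) := by
  have z1 : ∀ a : PathAlgebra k V, (0 : PathAlgebra k V) * a = 0 := fun a => by simp [mul_def]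
  have z2 : ∀ a : PathAlgebra k V, a * (0 : PathAlgebra k V) = 0 := fun a => by simp [mul_def]
  by_cases h : x' = y
  · subst h
    by_cases h' : x'' = y'
    · subst h'
      simp only [ofPath_mul_ofPath, Path.comp_assoc]
    · rw [ofPath_mul_ofPath, ofPath_mul_ofPath_of_ne _ _ h', ofPath_mul_ofPath_of_ne _ _ h', z2]
  · rw [ofPath_mul_ofPath_of_ne _ _ h, z1]
    by_cases h' : x'' = y'
    · subst h'
      rw [ofPath_mul_ofPath, ofPath_mul_ofPath_of_ne _ _ h]
    · rw [ofPath_mul_ofPath_of_ne _ _ h', z2]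

theorem mul_assoc' (a b c : PathAlgebra k V) : a * b * c = a * (b * c) := by
  let L := mulLinear k V
  have h1 : ∀ {x y x' y' : V} (p : Path x y) (q : Path x' y') (c : PathAlgebra k V),
      L (L (ofPath k p) (ofPath k q)) c = L (ofPath k p) (L (ofPath k q) c) := by
    intro x y x' y' p q c
    have : L (L (ofPath k p) (ofPath k q)) = (L (ofPath k p)).comp (L (ofPath k q)) :=
      linearMap_ext fun _ _ r => ofPath_mul_assoc p q r
    exact congrArg (fun f => f c) this
  have h2 : ∀ {x y : V} (p : Path x y) (b c : PathAlgebra k V),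
      L (L (ofPath k p) b) c = L (ofPath k p) (L b c) := by
    intro x y p b c
    have : (L.flip c).comp (L (ofPath k p)) = (L (ofPath k p)).comp (L.flip c) :=
      linearMap_ext fun _ _ q => h1 p q c
    exact congrArg (fun f => f b) this
  have h3 : (L.flip c).comp (L.flip b) = L.flip (L b c) :=
    linearMap_ext fun _ _ p => h2 p b c
  exact congrArg (fun f => f a) h3

variable [Fintype V]

/-- The unit of `kQ`: the sum of all stationary paths. -/
instance : One (PathAlgebra k V) := ⟨∑ x : V, ofPath k (Path.nil : Path x x)⟩

theorem one_def : (1 : PathAlgebra k V) = ∑ x : V, ofPath k (Path.nil : Path x x) := rfl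

theorem one_mul' (a : PathAlgebra k V) : 1 * a = a := by
  have key : mulLinear k V 1 = LinearMap.id := by
    refine linearMap_ext fun x y p => ?_
    rw [one_def, map_sum, LinearMap.sum_apply, Finset.sum_eq_single x]
    · rw [mulLinear_ofPath, basisMul_comp, Path.nil_comp]; rfl
    · intro z _ hz
      rw [mulLinear_ofPath, basisMul_of_ne _ _ hz.symm]
    · intro h; exact absurd (Finset.mem_univ x) h
  exact congrArg (fun f => f a) key

theorem mul_one' (a : PathAlgebra k V) : a * 1 = a := by
  have key : (mulLinear k V).flip 1 = LinearMap.id := by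
    refine linearMap_ext fun x y p => ?_
    rw [LinearMap.flip_apply, one_def, map_sum, Finset.sum_eq_single y]
    · rw [mulLinear_ofPath, basisMul_comp, Path.comp_nil]; rfl
    · intro z _ hz
      rw [mulLinear_ofPath, basisMul_of_ne _ _ hz]
    · intro h; exact absurd (Finset.mem_univ y) h
  exact congrArg (fun f => f a) key

instance : Ring (PathAlgebra k V) where
  __ := (inferInstance : AddCommGroup (PathAlgebra k V))
  mul := (· * ·)
  one := 1
  mul_assoc := mul_assoc'
  one_mul := one_mul'
  mul_one := mul_one'
  left_distrib a b c := map_add (mulLinear k V a) b c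
  right_distrib a b c := by simp [mul_def]
  zero_mul a := by simp [mul_def]
  mul_zero a := by simp [mul_def]

instance : Algebra k (PathAlgebra k V) :=
  Algebra.ofModule (fun r a b => by simp [mul_def]) (fun r a b => by simp [mul_def])

/-- The two-sided ideal `F` of `kQ` generated by the arrows. -/
def arrowIdeal (k : Type u) (V : Type v) [Quiver.{w} V] [Field k] [Fintype V] :
    Ideal (PathAlgebra k V) :=
  TwoSidedIdeal.asIdeal
    (TwoSidedIdeal.span {a | ∃ (x y : V) (e : x ⟶ y), a = ofPath k e.toPath})

/-- A two-sided ideal `I` of `kQ` is admissible if `F ^ m ⊆ I ⊆ F ^ 2` for some `m ≥ 2`. -/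
structure IsAdmissible (I : Ideal (PathAlgebra k V)) : Prop where
  isTwoSided : I.IsTwoSided
  exists_pow_le : ∃ m : ℕ, 2 ≤ m ∧ arrowIdeal k V ^ m ≤ I
  le_sq : I ≤ arrowIdeal k V ^ 2

end PathAlgebra

open PathAlgebra

/-! ## Presentations and triangular algebras -/

/-- A presentation of `A`: a surjective morphism of `k`-algebras `kQ → A` whose kernel is an
admissible ideal, where `Q` is a finite connected quiver. -/
structure IsPresentation {k : Type u} [Field k] {V : Type v} [Quiver.{w} V] [Fintype V]
    {A : Type*} [Ring A] [Algebra k A] (ν : PathAlgebra k V →ₐ[k] A) : Prop where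
  finite_arrows : ∀ x y : V, Finite (x ⟶ y)
  connected : IsConnectedQuiver V
  surjective : Function.Surjective ν
  admissible : IsAdmissible (RingHom.ker ν)

/-- A triangular algebra: an algebra that has a presentation by a finite connected quiver without
oriented cycles. (Having a presentation makes the algebra finite dimensional, basic and connected,
and determines the quiver up to isomorphism.) -/
def IsTriangularAlgebra (k : Type u) [Field k] (A : Type*) [Ring A] [Algebra k A] : Prop :=
  ∃ (V : Type) (_ : Quiver.{0} V) (_ : Fintype V) (ν : PathAlgebra k V →ₐ[k] A),
    IsAcyclicQuiver V ∧ IsPresentation ν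

/-! ## The fundamental group of a bound quiver -/

section FundamentalGroup

variable {k : Type u} [Field k] {V : Type v} [Quiver.{w} V] [Fintype V]

/-- `ρ = ∑ λᵢ wᵢ`, a linear combination of pairwise distinct paths `wᵢ` from `x` to `y` with
nonzero coefficients `λᵢ = ρ wᵢ`, is a minimal relation of `I`: it lies in `I`, has at least two
terms, and none of its nonempty proper partial sums lies in `I`. -/
structure IsMinimalRelation (I : Ideal (PathAlgebra k V)) {x y : V} (ρ : Path x y →₀ k) :
    Prop where
  mem : ∑ p ∈ ρ.support, ρ p • ofPath k p ∈ I
  two_le : 2 ≤ ρ.support.card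
  notMem : ∀ J : Finset (Path x y), J ⊂ ρ.support → J.Nonempty →
    ∑ p ∈ J, ρ p • ofPath k p ∉ I

/-- The homotopy relation: the smallest equivalence relation on walks that satisfies the last four
conditions. -/
inductive Homotopic (I : Ideal (PathAlgebra k V)) :
    ∀ {x y : Symmetrify V}, Walk V x y → Walk V x y → Prop
  | refl {x y : Symmetrify V} (p : Walk V x y) : Homotopic I p p
  | symm {x y : Symmetrify V} {p q : Walk V x y} : Homotopic I p q → Homotopic I q p
  | trans {x y : Symmetrify V} {p q r : Walk V x y} :
      Homotopic I p q → Homotopic I q r → Homotopic I p r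
  | arrow_inv {x y : V} (a : x ⟶ y) :
      Homotopic I ((arrowWalk a).comp (invArrowWalk a)) Path.nil
  | inv_arrow {x y : V} (a : x ⟶ y) :
      Homotopic I ((invArrowWalk a).comp (arrowWalk a)) Path.nil
  | minimal {x y : V} {ρ : Path x y →₀ k} (hρ : IsMinimalRelation I ρ) {p q : Path x y}
      (hp : p ∈ ρ.support) (hq : q ∈ ρ.support) : Homotopic I (pathWalk p) (pathWalk q)
  | congr {x' x y y' : Symmetrify V} (p : Walk V x' x) {q r : Walk V x y} (s : Walk V y y') :
      Homotopic I q r → Homotopic I ((p.comp q).comp s) ((p.comp r).comp s)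

namespace Homotopic

variable {I : Ideal (PathAlgebra k V)}

theorem comp_left {x y z : Symmetrify V} (p : Walk V x y) {q r : Walk V y z}
    (h : Homotopic I q r) :
    Homotopic I (p.comp q) (p.comp r) :=
  congr p Path.nil h

theorem comp_right {x y z : Symmetrify V} {q r : Walk V x y}
    (h : Homotopic I q r) (s : Walk V y z) :
    Homotopic I (q.comp s) (r.comp s) := by
  have := congr Path.nil s h
  rwa [Path.nil_comp, Path.nil_comp] at this

theorem comp {x y z : Symmetrify V} {p p' : Walk V x y} {q q' : Walk V y z}
    (h : Homotopic I p p') (h' : Homotopic I q q') : Homotopic I (p.comp q) (p'.comp q') :=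
  (h.comp_right q).trans (h'.comp_left p')

theorem comp_reverse (I : Ideal (PathAlgebra k V)) {x y : Symmetrify V} (p : Walk V x y) :
    Homotopic I (p.comp p.reverse) Path.nil ∧ Homotopic I (p.reverse.comp p) Path.nil := by
  induction p with
  | nil => exact ⟨refl _, refl _⟩
  | @cons b c p e ih =>
    have he : p.cons e = p.comp (@Hom.toPath (Symmetrify V) _ _ _ e) := rfl
    rw [he, Path.reverse_comp, Path.reverse_toPath]
    have hee : Homotopic I ((@Hom.toPath (Symmetrify V) _ _ _ e).comp
          (@Hom.toPath (Symmetrify V) _ _ _ (reverse e))) Path.nil ∧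
        Homotopic I ((@Hom.toPath (Symmetrify V) _ _ _ (reverse e)).comp
          (@Hom.toPath (Symmetrify V) _ _ _ e)) Path.nil := by
      rcases e with a | a
      · exact ⟨arrow_inv a, inv_arrow a⟩
      · exact ⟨inv_arrow a, arrow_inv a⟩
    constructor
    · have := congr p p.reverse hee.1
      rw [Path.comp_nil, Path.comp_assoc, Path.comp_assoc] at this
      rw [Path.comp_assoc]
      exact this.trans ih.1
    · have := congr (@Hom.toPath (Symmetrify V) _ _ _ (reverse e))
        (@Hom.toPath (Symmetrify V) _ _ _ e) ih.2
      rw [Path.comp_nil, Path.comp_assoc, Path.comp_assoc] at this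
      rw [Path.comp_assoc]
      exact this.trans hee.2

theorem reverse {x y : Symmetrify V} {p q : Walk V x y} (h : Homotopic I p q) :
    Homotopic I p.reverse q.reverse := by
  have h1 := ((comp_reverse I q).1.symm).comp_left p.reverse
  rw [Path.comp_nil, ← Path.comp_assoc] at h1
  have h2 := ((h.symm.comp_left p.reverse).trans (comp_reverse I p).2).comp_right q.reverse
  rw [Path.nil_comp] at h2
  exact h1.trans h2

end Homotopic

/-- Homotopy of closed walks at `x`. -/
def homotopySetoid (I : Ideal (PathAlgebra k V)) (x : V) : Setoid (Walk V x x) where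
  r := Homotopic I
  iseqv := ⟨Homotopic.refl, Homotopic.symm, Homotopic.trans⟩

/-- The fundamental group `π₁(Q, I, x)`: closed walks at `x` modulo homotopy. -/
def FundamentalGroup (I : Ideal (PathAlgebra k V)) (x : V) : Type (max v w) :=
  Quotient (homotopySetoid I x)

/-- The group structure is induced by the composition of walks. -/
instance (I : Ideal (PathAlgebra k V)) (x : V) : Group (FundamentalGroup I x) where
  mul := Quotient.map₂ Path.comp fun _ _ h _ _ h' => Homotopic.comp h h'
  one := Quotient.mk (homotopySetoid I x) Path.nil
  inv := Quotient.map Path.reverse fun _ _ h => Homotopic.reverse h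
  mul_assoc := by
    rintro ⟨a⟩ ⟨b⟩ ⟨c⟩
    exact congrArg (Quotient.mk (homotopySetoid I x)) (Path.comp_assoc a b c)
  one_mul := by
    rintro ⟨a⟩
    exact congrArg (Quotient.mk (homotopySetoid I x)) (Path.nil_comp a)
  mul_one := by
    rintro ⟨a⟩
    exact congrArg (Quotient.mk (homotopySetoid I x)) (Path.comp_nil a)
  inv_mul_cancel := by
    rintro ⟨a⟩
    exact Quotient.sound (Homotopic.comp_reverse I a).2

end FundamentalGroup

end

end BoundQuiver

/-! One algebra has many presentations, and changing the presentation changes which minimal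
relations occur. The construction uses this as a switch. Over a finite index set `T`, take the
quiver with three vertices `SwitchQuiver T`, and for each triple `h = (s, t, r)` let the auxiliary
arrow satisfy `aux h * snd (some t) = ε h • gen s * snd (some t) + gen r * snd none`, together with
`aux h * snd c = ε h • gen s * snd c` for the other `c`. The substitution `aux h ↦ aux h + λ • gen
s` alters `ε h` freely, so every choice of `ε` presents the same algebra (`matrixRep_mem_range`).

For `ε h = 0` the displayed relation only expresses the class of `aux h` through the other arrows.
For `ε h ≠ 0` it also gives `gen s * snd (some t) ~ gen r * snd none`, which in the fundamental
group becomes the product relation `s * t = r` (`homotopic_twoPath`). Conversely, the relations are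
homogeneous for a weight with values in `M` (`pathWeight_eq_of_isMinimalRelation`), so nothing else
is imposed. Hence every group presented by finitely many products of elements of `T` arises
(`nonempty_fundamentalGroup_switchPresentation_mulEquiv`).

Finitely generated abelian groups have such presentations: `ℤ` by the elements 0 and 1, finite
groups by their multiplication tables, and products by `IsProductPresentation.prod`. Pulling all of
them back to the product of the index sets gives a common `T`. -/

namespace BoundQuiver

open Quiver PathAlgebra

noncomputable section

/-! ## The universal property of the path algebra -/

namespace PathAlgebra

section Lift

variable {k : Type u} [Field k] {V : Type v} [Quiver.{w} V]
  {B : Type*} [Ring B] [Algebra k B]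

/-- The product of the images of the arrows of a path, where `e x` is the image of the
stationary path at `x`. -/
def pathImage (e : V → B) (f : ∀ {x y : V}, (x ⟶ y) → B) {x : V} : ∀ {y : V}, Path x y → B
  | _, .nil => e x
  | _, .cons p a => pathImage e f p * f a

variable {e : V → B} {f : ∀ {x y : V}, (x ⟶ y) → B}

theorem mul_pathImage {f : ∀ {x y : V}, (x ⟶ y) → B} (hee : ∀ x, e x * e x = e x)
    {x y : V} (p : Path x y) :
    e x * pathImage e f p = pathImage e f p := by
  induction p with
  | nil => exact hee x
  | cons p a ih => rw [pathImage, ← mul_assoc, ih]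

theorem pathImage_mul (hee : ∀ x, e x * e x = e x)
    (hr : ∀ {x y : V} (a : x ⟶ y), f a * e y = f a) {x y : V} (p : Path x y) :
    pathImage e f p * e y = pathImage e f p := by
  cases p with
  | nil => exact hee x
  | cons p a => rw [pathImage, mul_assoc, hr]

theorem pathImage_comp (hee : ∀ x, e x * e x = e x)
    (hr : ∀ {x y : V} (a : x ⟶ y), f a * e y = f a) {x y z : V} (p : Path x y) (q : Path y z) :
    pathImage e f (p.comp q) = pathImage e f p * pathImage e f q := by
  induction q with
  | nil => rw [Path.comp_nil, pathImage, pathImage_mul hee hr]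
  | cons q a ih => rw [Path.comp_cons, pathImage, ih, pathImage, mul_assoc]

variable [Fintype V]

/-- The algebra morphism out of `kQ` with prescribed values on stationary paths and arrows. -/
def lift (k : Type u) [Field k] [Algebra k B] (e : V → B) (f : ∀ {x y : V}, (x ⟶ y) → B)
    (he : CompleteOrthogonalIdempotents e)
    (hr : ∀ {x y : V} (a : x ⟶ y), f a * e y = f a) : PathAlgebra k V →ₐ[k] B :=
  AlgHom.ofLinearMap ((pathBasis k V).constr k fun p => pathImage e f p.2.2)
    (by
      rw [one_def, map_sum, ← he.complete]
      refine Finset.sum_congr rfl fun x _ => ?_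
      rw [ofPath, Module.Basis.constr_basis, pathImage])
    (by
      have hee : ∀ x, e x * e x = e x := fun x => he.idem x
      set F := (pathBasis k V).constr k fun p => pathImage e f p.2.2
      have hF : ∀ {x y : V} (p : Path x y), F (ofPath k p) = pathImage e f p := fun p => by
        simp only [F, ofPath, Module.Basis.constr_basis]
      have key : (mulLinear k V).compr₂ F = (LinearMap.mul k B).compl₁₂ F F := by
        refine linearMap_ext fun x y p => linearMap_ext fun x' y' q => ?_
        rw [LinearMap.compr₂_apply, LinearMap.compl₁₂_apply, LinearMap.mul_apply', hF, hF,
          ← mul_def]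
        by_cases h : x' = y
        · subst h
          rw [ofPath_mul_ofPath, hF, pathImage_comp hee hr]
        · rw [ofPath_mul_ofPath_of_ne _ _ h, map_zero, ← pathImage_mul hee hr p,
            ← mul_pathImage hee q, mul_assoc, ← mul_assoc (e y), he.ortho (Ne.symm h),
            zero_mul, mul_zero]
      exact fun a b => congrArg (fun g => g a b) key)

theorem lift_ofPath (he : CompleteOrthogonalIdempotents e)
    (hr : ∀ {x y : V} (a : x ⟶ y), f a * e y = f a) {x y : V} (p : Path x y) :
    lift k e f he hr (ofPath k p) = pathImage e f p := by
  change (pathBasis k V).constr k _ (pathBasis k V ⟨x, y, p⟩) = _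
  rw [Module.Basis.constr_basis]

theorem lift_mem (S : Subalgebra k B) (he : CompleteOrthogonalIdempotents e)
    (hr : ∀ {x y : V} (a : x ⟶ y), f a * e y = f a)
    (heS : ∀ x, e x ∈ S) (hfS : ∀ {x y : V} (a : x ⟶ y), f a ∈ S) (a : PathAlgebra k V) :
    lift k e f he hr a ∈ S := by
  have hp : ∀ {x y : V} (p : Path x y), pathImage e f p ∈ S := by
    intro x y p
    induction p with
    | nil => exact heS x
    | cons p a ih => exact S.mul_mem ih (hfS a)
  have h := (pathBasis k V).mem_span a
  induction h using Submodule.span_induction with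
  | zero => rw [map_zero]; exact S.zero_mem
  | add a b _ _ ha hb => rw [map_add]; exact S.add_mem ha hb
  | smul c a _ ha => rw [map_smul]; exact S.smul_mem ha c
  | mem a ha =>
    obtain ⟨p, rfl⟩ := ha
    exact (lift_ofPath (k := k) he hr p.2.2).symm ▸ hp p.2.2

end Lift

/-! ## Powers of the arrow ideal -/

section Length

variable (k : Type u) [Field k] (V : Type v) [Quiver.{w} V] [Fintype V]

/-- The subspace of `kQ` spanned by the paths of length at least `m`. -/
def lengthFiltration (m : ℕ) : Submodule k (PathAlgebra k V) :=
  Submodule.span k {a | ∃ (x y : V) (p : Path x y), m ≤ p.length ∧ a = ofPath k p}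

variable {k V}

theorem mul_mem_lengthFiltration {m n : ℕ} {a b : PathAlgebra k V}
    (ha : a ∈ lengthFiltration k V m) (hb : b ∈ lengthFiltration k V n) :
    a * b ∈ lengthFiltration k V (m + n) := by
  induction ha using Submodule.span_induction with
  | zero => rw [zero_mul]; exact Submodule.zero_mem _
  | add _ _ _ _ h h' => rw [add_mul]; exact Submodule.add_mem _ h h'
  | smul c _ _ h => rw [smul_mul_assoc]; exact Submodule.smul_mem _ c h
  | mem a ha =>
    obtain ⟨x, y, p, hp, rfl⟩ := ha
    induction hb using Submodule.span_induction with
    | zero => rw [mul_zero]; exact Submodule.zero_mem _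
    | add _ _ _ _ h h' => rw [mul_add]; exact Submodule.add_mem _ h h'
    | smul c _ _ h => rw [mul_smul_comm]; exact Submodule.smul_mem _ c h
    | mem b hb =>
      obtain ⟨x', y', q, hq, rfl⟩ := hb
      by_cases h : x' = y
      · subst h
        rw [ofPath_mul_ofPath]
        exact Submodule.subset_span ⟨_, _, _, by rw [Path.length_comp]; omega, rfl⟩
      · rw [ofPath_mul_ofPath_of_ne _ _ h]
        exact Submodule.zero_mem _

theorem mem_lengthFiltration_zero (a : PathAlgebra k V) : a ∈ lengthFiltration k V 0 := by
  refine Submodule.span_mono ?_ ((pathBasis k V).mem_span a)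
  rintro _ ⟨p, rfl⟩
  exact ⟨p.1, p.2.1, p.2.2, Nat.zero_le _, rfl⟩

theorem lengthFiltration_eq_bot {m : ℕ} (h : ∀ {x y : V} (p : Path x y), p.length < m) :
    lengthFiltration k V m = ⊥ := by
  rw [lengthFiltration, Submodule.span_eq_bot]
  rintro _ ⟨x, y, p, hp, rfl⟩
  exact absurd hp (not_le.mpr (h p))

theorem ofPath_mem_arrowIdeal {x y : V} (a : x ⟶ y) : ofPath k a.toPath ∈ arrowIdeal k V :=
  TwoSidedIdeal.subset_span ⟨x, y, a, rfl⟩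

/-- An induction principle: a subspace stable under multiplication on both sides is a two-sided
ideal, so it contains the span of the arrows. -/
theorem mem_of_mem_arrowIdeal (S : Submodule k (PathAlgebra k V))
    (harrow : ∀ {x y : V} (e : x ⟶ y), ofPath k e.toPath ∈ S)
    (hl : ∀ {a b}, b ∈ S → a * b ∈ S) (hr : ∀ {a b}, a ∈ S → a * b ∈ S)
    {a : PathAlgebra k V} (ha : a ∈ arrowIdeal k V) : a ∈ S := by
  let J : TwoSidedIdeal (PathAlgebra k V) :=
    TwoSidedIdeal.mk' (S : Set (PathAlgebra k V)) S.zero_mem (fun hx hy => add_mem hx hy)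
      (fun hx => S.neg_mem hx) hl hr
  have hJ : TwoSidedIdeal.span {a | ∃ (x y : V) (e : x ⟶ y), a = ofPath k e.toPath} ≤ J := by
    rw [TwoSidedIdeal.span_le]
    rintro _ ⟨x, y, e, rfl⟩
    exact (TwoSidedIdeal.mem_mk' ..).mpr (harrow e)
  exact (TwoSidedIdeal.mem_mk' ..).mp (hJ ha)

theorem mem_lengthFiltration_one {a : PathAlgebra k V} (ha : a ∈ arrowIdeal k V) :
    a ∈ lengthFiltration k V 1 := by
  refine mem_of_mem_arrowIdeal (lengthFiltration k V 1) (fun {x y} e => ?_) (fun {a b} hb => ?_)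
    (fun {a b} ha => ?_) ha
  · exact Submodule.subset_span ⟨x, y, e.toPath, le_rfl, rfl⟩
  · have := mul_mem_lengthFiltration (mem_lengthFiltration_zero a) hb
    rwa [zero_add] at this
  · have := mul_mem_lengthFiltration ha (mem_lengthFiltration_zero b)
    rwa [add_zero] at this

theorem arrowIdeal_pow_le (m : ℕ) {a : PathAlgebra k V} (ha : a ∈ arrowIdeal k V ^ m) :
    a ∈ lengthFiltration k V m := by
  induction m generalizing a with
  | zero => exact mem_lengthFiltration_zero a
  | succ m ih =>
    rcases Nat.eq_zero_or_pos m with rfl | hm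
    · rw [zero_add, Submodule.pow_one] at ha
      exact mem_lengthFiltration_one ha
    rw [Submodule.pow_succ] at ha
    induction ha using Submodule.mul_induction_on' with
    | mem_mul_mem r hr s hs => exact mul_mem_lengthFiltration (ih hr) (mem_lengthFiltration_one hs)
    | add r _ s _ h h' => exact Submodule.add_mem _ h h'

end Length

end PathAlgebra

end

end BoundQuiver

namespace BoundQuiver

open Quiver PathAlgebra

noncomputable section

/-! ## Weights on arrows and the fundamental group -/

section Weight

variable {V : Type v} [Quiver.{w} V] {G : Type*} [Group G]

/-- The weight of a walk: the product of the weights of its arrows. -/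
def walkWeight (ω : ∀ {x y : V}, (x ⟶ y) → G) {x : Symmetrify V} :
    ∀ {y : Symmetrify V}, Walk V x y → G
  | _, .nil => 1
  | _, .cons p (Sum.inl a) => walkWeight ω p * ω a
  | _, .cons p (Sum.inr a) => walkWeight ω p * (ω a)⁻¹

/-- The weight of a path: the product of the weights of its arrows. -/
def pathWeight (ω : ∀ {x y : V}, (x ⟶ y) → G) {x : V} : ∀ {y : V}, Path x y → G
  | _, .nil => 1
  | _, .cons p a => pathWeight ω p * ω a

variable (ω : ∀ {x y : V}, (x ⟶ y) → G)

theorem walkWeight_comp {x y z : Symmetrify V} (p : Walk V x y) (q : Walk V y z) :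
    walkWeight ω (p.comp q) = walkWeight ω p * walkWeight ω q := by
  induction q with
  | nil => simp [walkWeight]
  | cons q a ih => rcases a with a | a <;> simp [walkWeight, ih, mul_assoc]

theorem walkWeight_arrowWalk {x y : V} (a : x ⟶ y) : walkWeight ω (arrowWalk a) = ω a :=
  one_mul _

theorem walkWeight_invArrowWalk {x y : V} (a : x ⟶ y) :
    walkWeight ω (invArrowWalk a) = (ω a)⁻¹ :=
  one_mul _

theorem walkWeight_reverse {x y : Symmetrify V} (p : Walk V x y) :
    walkWeight ω p.reverse = (walkWeight ω p)⁻¹ := by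
  induction p with
  | nil => simp [walkWeight]
  | cons p a ih =>
    rw [Path.reverse, walkWeight_comp, ih]
    rcases a with a | a
    · exact (congrArg (· * _) (walkWeight_invArrowWalk ω a)).trans (mul_inv_rev _ _).symm
    · exact (congrArg (· * _) (walkWeight_arrowWalk ω a)).trans (by simp [walkWeight])

theorem walkWeight_pathWalk {x y : V} (p : Path x y) :
    walkWeight ω (pathWalk p) = pathWeight ω p := by
  induction p with
  | nil => rfl
  | cons p a ih => exact congrArg (· * ω a) ih

theorem walkWeight_conj {o o' x y : Symmetrify V} {s : Walk V o x} {t : Walk V o' y}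
    (hs : walkWeight ω s = 1) (ht : walkWeight ω t = 1) (p : Walk V x y) :
    walkWeight ω ((s.comp p).comp t.reverse) = walkWeight ω p := by
  rw [walkWeight_comp, walkWeight_comp, walkWeight_reverse, hs, ht, one_mul, inv_one, mul_one]

variable {k : Type u} [Field k] [Fintype V] {I : Ideal (PathAlgebra k V)}

/-- The weight of a walk depends only on its homotopy class if minimal relations are
homogeneous. -/
theorem Homotopic.walkWeight_eq
    (hω : ∀ {x y : V} {ρ : Path x y →₀ k}, IsMinimalRelation I ρ →
      ∀ p ∈ ρ.support, ∀ q ∈ ρ.support, pathWeight ω p = pathWeight ω q)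
    {x y : Symmetrify V} {p q : Walk V x y} (h : Homotopic I p q) :
    walkWeight ω p = walkWeight ω q := by
  induction h with
  | refl => rfl
  | symm _ ih => exact ih.symm
  | trans _ _ ih ih' => exact ih.trans ih'
  | arrow_inv a =>
    exact (walkWeight_comp ω _ _).trans ((congrArg₂ (· * ·) (walkWeight_arrowWalk ω a)
      (walkWeight_invArrowWalk ω a)).trans (mul_inv_cancel (ω a)))
  | inv_arrow a =>
    exact (walkWeight_comp ω _ _).trans ((congrArg₂ (· * ·) (walkWeight_invArrowWalk ω a)
      (walkWeight_arrowWalk ω a)).trans (inv_mul_cancel (ω a)))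
  | minimal hρ hp hq => rw [walkWeight_pathWalk, walkWeight_pathWalk, hω hρ _ hp _ hq]
  | congr p s _ ih => simp only [walkWeight_comp, ih]

/-- The weight as a group morphism on the fundamental group. -/
def weightHom
    (hω : ∀ {x y : V} {ρ : Path x y →₀ k}, IsMinimalRelation I ρ →
      ∀ p ∈ ρ.support, ∀ q ∈ ρ.support, pathWeight ω p = pathWeight ω q) (x : V) :
    FundamentalGroup I x →* G where
  toFun := Quotient.lift (walkWeight ω) fun _ _ h => Homotopic.walkWeight_eq ω hω h
  map_one' := rfl
  map_mul' := by
    rintro ⟨a⟩ ⟨b⟩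
    exact walkWeight_comp ω a b

/-! ### Closing up walks at a base point. -/

namespace Homotopic

theorem conj_nil {o x : Symmetrify V} (s : Walk V o x) :
    Homotopic I ((s.comp Path.nil).comp s.reverse) Path.nil := by
  rw [Path.comp_nil]
  exact (comp_reverse I s).1

theorem conj_comp {o x y z : Symmetrify V} (s : Walk V o x) (t : Walk V o y) (r : Walk V o z)
    (p : Walk V x y) (q : Walk V y z) :
    Homotopic I ((s.comp (p.comp q)).comp r.reverse)
      (((s.comp p).comp t.reverse).comp ((t.comp q).comp r.reverse)) := by
  have h := ((comp_reverse I t).2.symm.comp_right (q.comp r.reverse)).comp_left (s.comp p)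
  rw [Path.nil_comp] at h
  simp only [Path.comp_assoc] at h ⊢
  exact h

theorem conj_conj {o x y : Symmetrify V} (s : Walk V o x) (t : Walk V o y) (p : Walk V x y) :
    Homotopic I (s.reverse.comp (((s.comp p).comp t.reverse).comp t)) p := by
  have h1 := (comp_reverse I s).2.comp_right p
  have h2 := (comp_reverse I t).2.comp_left (s.reverse.comp (s.comp p))
  rw [Path.nil_comp, Path.comp_assoc] at h1
  rw [Path.comp_nil] at h2
  simp only [Path.comp_assoc] at h1 h2 ⊢
  exact h2.trans h1

end Homotopic

/-- The homotopy class of the walk `p`, closed up by the walks `τ` from the base point. -/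
def closedUp (I : Ideal (PathAlgebra k V)) {o : V} (τ : ∀ x : Symmetrify V, Walk V o x)
    {x y : Symmetrify V} (p : Walk V x y) : FundamentalGroup I o :=
  Quotient.mk (homotopySetoid I o) (((τ x).comp p).comp (τ y).reverse)

variable {o : V} (τ : ∀ x : Symmetrify V, Walk V o x)

/-- Closing up loses no information, because `conj_conj` recovers the walk up to homotopy. -/
theorem closedUp_eq_iff {x y : Symmetrify V} {p q : Walk V x y} :
    closedUp I τ p = closedUp I τ q ↔ Homotopic I p q :=
  ⟨fun h => (Homotopic.conj_conj (τ x) (τ y) p).symm.trans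
    ((((Quotient.exact h).comp_right _).comp_left _).trans (Homotopic.conj_conj (τ x) (τ y) q)),
    fun h => Quotient.sound (Homotopic.congr _ _ h)⟩

theorem closedUp_nil (x : Symmetrify V) : closedUp I τ (Path.nil : Walk V x x) = 1 :=
  Quotient.sound (Homotopic.conj_nil (τ x))

theorem closedUp_comp {x y z : Symmetrify V} (p : Walk V x y) (q : Walk V y z) :
    closedUp I τ (p.comp q) = closedUp I τ p * closedUp I τ q :=
  Quotient.sound (Homotopic.conj_comp (τ x) (τ y) (τ z) p q)

theorem closedUp_invArrowWalk {x y : V} (a : x ⟶ y) :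
    closedUp I τ (invArrowWalk a) = (closedUp I τ (arrowWalk a))⁻¹ := by
  refine eq_inv_of_mul_eq_one_left ?_
  exact (closedUp_comp τ _ _).symm.trans
    (((closedUp_eq_iff τ).mpr (Homotopic.inv_arrow a)).trans (closedUp_nil τ y))

/-- The class of any walk is a function of its weight; this yields injectivity of the weight
morphism. -/
theorem map_walkWeight (φ : G →* FundamentalGroup I o)
    (hφ : ∀ {x y : V} (a : x ⟶ y), φ (ω a) = closedUp I τ (arrowWalk a)) {x y : Symmetrify V}
    (p : Walk V x y) : φ (walkWeight ω p) = closedUp I τ p := by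
  induction p with
  | nil => exact (map_one φ).trans (closedUp_nil τ x).symm
  | cons p a ih =>
    rcases a with a | a
    · exact (map_mul φ _ _).trans ((congrArg₂ (· * ·) ih (hφ a)).trans
        (closedUp_comp τ p (arrowWalk a)).symm)
    · exact (map_mul φ _ _).trans ((congrArg₂ (· * ·) ih ((map_inv φ _).trans
        ((congrArg _ (hφ a)).trans (closedUp_invArrowWalk τ a).symm))).trans
          (closedUp_comp τ p (invArrowWalk a)).symm)

/-- The fundamental group is the group `G` if `G` is generated by the weights of the arrows,
minimal relations are homogeneous, and the classes of the arrows are determined by their weights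
through a group morphism. -/
theorem nonempty_fundamentalGroup_mulEquiv
    (hω : ∀ {x y : V} {ρ : Path x y →₀ k}, IsMinimalRelation I ρ →
      ∀ p ∈ ρ.support, ∀ q ∈ ρ.support, pathWeight ω p = pathWeight ω q)
    (hgen : Subgroup.closure {g : G | ∃ (x y : V) (a : x ⟶ y), ω a = g} = ⊤)
    (hτ : ∀ x, walkWeight ω (τ x) = 1) (φ : G →* FundamentalGroup I o)
    (hφ : ∀ {x y : V} (a : x ⟶ y), φ (ω a) = closedUp I τ (arrowWalk a)) (x : V) :
    Nonempty (FundamentalGroup I x ≃* G) := by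
  -- `φ` is a section of the weight morphism at `o`; it suffices to check this on the weights of the
  -- arrows, which generate `G`.
  have hid : (weightHom ω hω o).comp φ = MonoidHom.id G := by
    refine MonoidHom.eq_of_eqOn_dense hgen ?_
    rintro _ ⟨x, y, a, rfl⟩
    change weightHom ω hω o (φ (ω a)) = ω a
    rw [hφ]
    exact (walkWeight_conj ω (hτ x) (hτ y) _).trans (walkWeight_arrowWalk ω a)
  refine ⟨MulEquiv.ofBijective (weightHom ω hω x) ⟨?_, fun g => ?_⟩⟩
  · rw [injective_iff_map_eq_one]
    rintro ⟨p⟩ hp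
    have hp' : walkWeight ω p = 1 := hp
    have h := map_walkWeight ω τ φ hφ p
    rw [hp', map_one, ← closedUp_nil τ x] at h
    exact Quotient.sound ((closedUp_eq_iff τ).mp h.symm)
  · obtain ⟨p, hp⟩ := Quotient.exists_rep (φ g)
    -- A closed walk at `o` that represents `φ g` is moved to `x` along `τ x`, which has weight one.
    refine ⟨Quotient.mk _ (((τ x).reverse.comp p).comp (τ x)), ?_⟩
    have hτ' (x : Symmetrify V) : walkWeight ω (τ x).reverse = 1 :=
      (walkWeight_reverse ω (τ x)).trans ((congrArg _ (hτ x)).trans inv_one)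
    refine ((congrArg (walkWeight ω) (congrArg _ (Path.reverse_reverse (τ x)).symm)).trans
      (walkWeight_conj ω (hτ' x) (hτ' x) p)).trans ?_
    have := congrArg (fun f : G →* G => f g) hid
    change weightHom ω hω o (φ g) = g at this
    rwa [← hp] at this

end Weight

/-! ## Minimal relations -/

section Minimal

variable {k : Type u} [Field k] {V : Type v} [Quiver.{w} V] [Fintype V]
  {I : Ideal (PathAlgebra k V)}

/-- Minimal relations are homogeneous if the ideal is cut out by functionals that are supported
on paths of a single degree. -/
theorem IsMinimalRelation.degree_eq {x y : V} {ρ : Path x y →₀ k} (hρ : IsMinimalRelation I ρ)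
    {D ι : Type*} (deg : Path x y → D) (ℓ : ι → PathAlgebra k V →ₗ[k] k)
    (hI : ∀ a, a ∈ I ↔ ∀ i, ℓ i a = 0)
    (hℓ : ∀ i (p q : Path x y), ℓ i (ofPath k p) ≠ 0 → ℓ i (ofPath k q) ≠ 0 → deg p = deg q)
    {p q : Path x y} (hp : p ∈ ρ.support) (hq : q ∈ ρ.support) : deg p = deg q := by
  classical
  by_contra hne
  -- The part of `ρ` in the degree of `p` would be a proper partial sum in `I`: each functional sees
  -- a single degree, so on this part it takes either its value on all of `ρ`, which is zero, or
  -- zero trivially.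
  refine hρ.notMem (ρ.support.filter fun r => deg r = deg p)
    (Finset.filter_ssubset.mpr ⟨q, hq, fun h => hne h.symm⟩)
    ⟨p, Finset.mem_filter.mpr ⟨hp, rfl⟩⟩ ?_
  rw [hI]
  intro i
  have h0 := (hI _).mp hρ.mem i
  simp only [map_sum, map_smul] at h0 ⊢
  by_cases h : ∃ r : Path x y, deg r = deg p ∧ ℓ i (ofPath k r) ≠ 0
  · obtain ⟨r, hr, hr0⟩ := h
    rw [← h0]
    refine Finset.sum_subset (Finset.filter_subset _ _) fun s hs hs' => ?_
    by_cases hs0 : ℓ i (ofPath k s) = 0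
    · rw [hs0, smul_zero]
    · exact absurd (Finset.mem_filter.mpr ⟨hs, (hℓ i s r hs0 hr0).trans hr⟩) hs'
  · push Not at h
    refine Finset.sum_eq_zero fun s hs => ?_
    rw [h s (Finset.mem_filter.mp hs).2, smul_zero]

/-- The paths of a relation are homotopic if functionals vanishing on the ideal link each of them
to a fixed one. -/
theorem homotopic_of_linked {x y : V} {ρ : Path x y →₀ k}
    (hρ : ∑ p ∈ ρ.support, ρ p • ofPath k p ∈ I) {p : Path x y} (hp : p ∈ ρ.support)
    (hlink : ∀ q ∈ ρ.support, q ≠ p → ∃ ℓ : PathAlgebra k V →ₗ[k] k, (∀ a ∈ I, ℓ a = 0) ∧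
      ℓ (ofPath k p) ≠ 0 ∧ ℓ (ofPath k q) ≠ 0 ∧
      ∀ r ∈ ρ.support, r ≠ p → r ≠ q → ℓ (ofPath k r) = 0)
    {q : Path x y} (hq : q ∈ ρ.support) : Homotopic I (pathWalk p) (pathWalk q) := by
  classical
  rcases eq_or_ne q p with rfl | hqp
  · exact Homotopic.refl _
  -- The functional linking `p` and `r` sees only these two terms, so a partial sum in `I` contains
  -- both or neither. A nonempty one is therefore all of `ρ`, and `ρ` is minimal.
  have hmem : ∀ J : Finset (Path x y), J ⊆ ρ.support → ∑ p ∈ J, ρ p • ofPath k p ∈ I →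
      ∀ r ∈ ρ.support, (r ∈ J ↔ p ∈ J) := by
    intro J hJ hJI r hr
    rcases eq_or_ne r p with rfl | hrp
    · rfl
    obtain ⟨ℓ, hℓI, hℓp, hℓr, hℓ⟩ := hlink r hr hrp
    have h0 := hℓI _ hJI
    simp only [map_sum, map_smul] at h0
    have hp0 := Finsupp.mem_support_iff.mp hp
    have hr0 := Finsupp.mem_support_iff.mp hr
    constructor
    · intro hrJ
      by_contra hpJ
      rw [Finset.sum_eq_single_of_mem r hrJ fun s hs hsr => by
        rw [hℓ s (hJ hs) (fun h => hpJ (h ▸ hs)) hsr, smul_zero]] at h0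
      exact (smul_ne_zero hr0 hℓr) h0
    · intro hpJ
      by_contra hrJ
      rw [Finset.sum_eq_single_of_mem p hpJ fun s hs hsp => by
        rw [hℓ s (hJ hs) hsp (fun h => hrJ (h ▸ hs)), smul_zero]] at h0
      exact (smul_ne_zero hp0 hℓp) h0
  refine Homotopic.minimal (ρ := ρ) ⟨hρ, ?_, fun J hJ hJne hJI => ?_⟩ hp hq
  · exact Finset.one_lt_card.mpr ⟨p, hp, q, hq, hqp.symm⟩
  · have h := hmem J hJ.1 hJI
    obtain ⟨r, hr⟩ := hJne
    exact hJ.2 fun s hs => (h s hs).mpr ((h r (hJ.1 hr)).mp hr)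

end Minimal

end

end BoundQuiver

namespace BoundQuiver

/-! ## Groups determined by finitely many products -/

/-- The group `M` is generated by the family `σ`, which contains the unit, subject to the
relations `σ s * σ t = σ r` that hold in `M`. -/
structure IsProductPresentation {T : Type} {M : Type*} [Group M] (σ : T → M) : Prop where
  exists_eq_one : ∃ e, σ e = 1
  closure_range : Subgroup.closure (Set.range σ) = ⊤
  exists_hom : ∀ {H : Type} [Group H] (f : T → H),
    (∀ s t r, σ s * σ t = σ r → f s * f t = f r) → ∃ φ : M →* H, ∀ t, φ (σ t) = f t

/-! ### Product presentations: examples and closure properties. -/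

namespace IsProductPresentation

/-- The full multiplication table is a presentation, and a finite one when the group is finite. -/
theorem id (M : Type) [Group M] : IsProductPresentation (fun m : M => m) where
  exists_eq_one := ⟨1, rfl⟩
  closure_range := by simp
  exists_hom f hf := ⟨MonoidHom.mk' f fun a b => (hf a b _ rfl).symm, fun _ => rfl⟩

/-- The product `0 + 0 = 0` forces the image of 0 to be the unit, and the image of 1 stays free. -/
theorem int :
    IsProductPresentation fun b : Bool => Multiplicative.ofAdd (if b then (1 : ℤ) else 0) where
  exists_eq_one := ⟨false, rfl⟩
  closure_range := by
    rw [eq_top_iff]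
    intro m _
    have h : Multiplicative.ofAdd (1 : ℤ) ∈ Subgroup.closure
        (Set.range fun b : Bool => Multiplicative.ofAdd (if b then (1 : ℤ) else 0)) :=
      Subgroup.subset_closure ⟨true, rfl⟩
    have := Subgroup.zpow_mem _ h m.toAdd
    rwa [← ofAdd_zsmul, smul_eq_mul, mul_one, ofAdd_toAdd] at this
  exists_hom f hf := by
    refine ⟨zpowersHom _ (f true), fun b => ?_⟩
    cases b
    · have h := hf false false false rfl
      rw [mul_eq_left] at h
      simp [h]
    · simp

variable {T T' : Type} {M : Type u} {N : Type v} [Group M] [Group N] {σ : T → M} {σ' : T' → N}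

theorem mulEquiv (h : IsProductPresentation σ) (g : M ≃* N) :
    IsProductPresentation fun t => g (σ t) where
  exists_eq_one := by
    obtain ⟨e, he⟩ := h.exists_eq_one
    exact ⟨e, by simp [he]⟩
  closure_range := by
    have := congrArg (Subgroup.map g.toMonoidHom) h.closure_range
    rw [MonoidHom.map_closure, ← Set.range_comp, Subgroup.map_top_of_surjective _ g.surjective]
      at this
    exact this
  exists_hom f hf := by
    obtain ⟨φ, hφ⟩ := h.exists_hom f fun s t r hr => hf s t r (by rw [← map_mul, hr])
    exact ⟨φ.comp g.symm.toMonoidHom, fun t => by simp [hφ]⟩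

/-- Repeating generators is harmless: if `s` and `t` have the same value, the relation `σ s * 1 = σ
t` makes their images equal. -/
theorem comp_surjective (h : IsProductPresentation σ) {π : T' → T}
    (hπ : Function.Surjective π) : IsProductPresentation fun t => σ (π t) where
  exists_eq_one := by
    obtain ⟨e, he⟩ := h.exists_eq_one
    obtain ⟨e', rfl⟩ := hπ e
    exact ⟨e', he⟩
  closure_range := by
    rw [← h.closure_range, ← hπ.range_comp σ]
    rfl
  exists_hom f hf := by
    obtain ⟨e, he⟩ := h.exists_eq_one
    obtain ⟨e', rfl⟩ := hπ e
    obtain ⟨φ, hφ⟩ := h.exists_hom (fun t => f (Function.surjInv hπ t)) fun s t r hr =>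
      hf _ _ _ (by simpa only [Function.surjInv_eq hπ] using hr)
    have h1 : f e' = 1 := by simpa using hf e' e' e' (by simp [he])
    refine ⟨φ, fun t => ?_⟩
    rw [hφ]
    have := hf (Function.surjInv hπ (π t)) e' t (by rw [Function.surjInv_eq hπ, he, mul_one])
    rwa [h1, mul_one] at this

/-- Commutation of the two factors is itself a consequence of product relations, since `(t, e') *
(e, t')` and `(e, t') * (t, e')` both equal `(t, t')`. -/
theorem prod (h : IsProductPresentation σ) (h' : IsProductPresentation σ') :
    IsProductPresentation fun t : T × T' => (σ t.1, σ' t.2) where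
  exists_eq_one := by
    obtain ⟨e, he⟩ := h.exists_eq_one
    obtain ⟨e', he'⟩ := h'.exists_eq_one
    exact ⟨(e, e'), by simp [he, he']⟩
  closure_range := by
    obtain ⟨e, he⟩ := h.exists_eq_one
    obtain ⟨e', he'⟩ := h'.exists_eq_one
    set K := Subgroup.closure (Set.range fun t : T × T' => (σ t.1, σ' t.2)) with hK
    have h1 : (⊤ : Subgroup M) ≤ K.comap (MonoidHom.inl M N) := by
      rw [← h.closure_range, Subgroup.closure_le]
      rintro _ ⟨t, rfl⟩
      exact Subgroup.subset_closure ⟨(t, e'), by simp [he']⟩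
    have h2 : (⊤ : Subgroup N) ≤ K.comap (MonoidHom.inr M N) := by
      rw [← h'.closure_range, Subgroup.closure_le]
      rintro _ ⟨t, rfl⟩
      exact Subgroup.subset_closure ⟨(e, t), by simp [he]⟩
    rw [eq_top_iff]
    rintro ⟨m, m'⟩ _
    have := K.mul_mem (h1 (Subgroup.mem_top m)) (h2 (Subgroup.mem_top m'))
    simpa using this
  exists_hom {H} _ f hf := by
    obtain ⟨e, he⟩ := h.exists_eq_one
    obtain ⟨e', he'⟩ := h'.exists_eq_one
    obtain ⟨φ, hφ⟩ := h.exists_hom (fun t => f (t, e')) fun s t r hr =>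
      hf _ _ _ (by simp [he', hr])
    obtain ⟨ψ, hψ⟩ := h'.exists_hom (fun t => f (e, t)) fun s t r hr =>
      hf _ _ _ (by simp [he, hr])
    -- Commutation is checked on pairs of generators and extended one factor at a time, as
    -- centralizers are subgroups.
    have hcomm : ∀ m m', Commute (φ m) (ψ m') := by
      have h1 : ∀ t m', Commute (φ (σ t)) (ψ m') := by
        intro t m'
        have : (⊤ : Subgroup N) ≤ (Subgroup.centralizer {φ (σ t)}).comap ψ := by
          rw [← h'.closure_range, Subgroup.closure_le]
          rintro _ ⟨t', rfl⟩
          rw [SetLike.mem_coe, Subgroup.mem_comap, Subgroup.mem_centralizer_singleton_iff, hφ, hψ,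
            hf (e, t') (t, e') (t, t') (by simp [he, he']),
            hf (t, e') (e, t') (t, t') (by simp [he, he'])]
        exact (Subgroup.mem_centralizer_singleton_iff.mp (this (Subgroup.mem_top m'))).symm
      intro m m'
      have : (⊤ : Subgroup M) ≤ (Subgroup.centralizer {ψ m'}).comap φ := by
        rw [← h.closure_range, Subgroup.closure_le]
        rintro _ ⟨t, rfl⟩
        exact Subgroup.mem_centralizer_singleton_iff.mpr (h1 t m')
      exact Subgroup.mem_centralizer_singleton_iff.mp (this (Subgroup.mem_top m))
    refine ⟨MonoidHom.noncommCoprod φ ψ hcomm, fun t => ?_⟩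
    rw [MonoidHom.noncommCoprod_apply, hφ, hψ]
    exact hf _ _ _ (by simp [he, he'])

end IsProductPresentation

/-! ### Finite product presentations of finitely generated abelian groups. -/

theorem exists_isProductPresentation_pi (M : Type) [Group M] {T : Type} [Finite T] {σ : T → M}
    (h : IsProductPresentation σ) (ι : Type) [Finite ι] :
    ∃ (T' : Type) (_ : Finite T') (σ' : T' → ι → M), IsProductPresentation σ' := by
  induction ι using Finite.induction_empty_option with
  | of_equiv e ih =>
    obtain ⟨T', _, σ', h'⟩ := ih
    exact ⟨T', inferInstance, _, h'.mulEquiv (MulEquiv.arrowCongr e (MulEquiv.refl M))⟩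
  | h_empty =>
    exact ⟨PEmpty → M, inferInstance, _, IsProductPresentation.id _⟩
  | h_option ih =>
    obtain ⟨T', _, σ', h'⟩ := ih
    exact ⟨T × T', inferInstance, _, (h.prod h').mulEquiv
      (MulEquiv.mk' (Equiv.piOptionEquivProd (β := fun _ => M)).symm fun a b => by
        funext i
        cases i <;> rfl)⟩

/-- By the structure theorem the group is a power of `ℤ` times a finite group. -/
theorem exists_isProductPresentation (M : Type v) [CommGroup M] [Group.FG M] :
    ∃ (T : Type) (_ : Finite T) (σ : T → M), IsProductPresentation σ := by
  obtain ⟨ι, j, _, _, p, hp, e, ⟨g⟩⟩ := CommGroup.equiv_free_prod_prod_multiplicative_zmod M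
  obtain ⟨T, _, σ, hσ⟩ := exists_isProductPresentation_pi _ IsProductPresentation.int j
  have : ∀ i, NeZero (p i ^ e i) := fun i => ⟨pow_ne_zero _ (hp i).ne_zero⟩
  have : ∀ i, Finite (Multiplicative (ZMod (p i ^ e i))) := fun i =>
    Finite.of_equiv (ZMod (p i ^ e i)) Multiplicative.ofAdd
  exact ⟨_, inferInstance, _, (hσ.prod (IsProductPresentation.id _)).mulEquiv g.symm⟩

end BoundQuiver

namespace BoundQuiver

open Quiver PathAlgebra

noncomputable section

/-! ## A quiver with three vertices -/

/-- The vertices of the quiver `source ⟶ middle ⟶ target` whose arrows are listed in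
`SwitchQuiver.Arrow`. -/
inductive SwitchQuiver (T : Type) : Type
  | source | middle | target

namespace SwitchQuiver

variable {T : Type}

/-- There is an arrow `gen s` from the source to the middle for every `s : T`, an auxiliary arrow
`aux s t r` parallel to them for every triple, and an arrow `snd c` from the middle to the
target for every `c : Option T`. -/
inductive Arrow : SwitchQuiver T → SwitchQuiver T → Type
  | fst (a : T ⊕ T × T × T) : Arrow source middle
  | snd (c : Option T) : Arrow middle target

instance : Quiver.{0} (SwitchQuiver T) := ⟨Arrow⟩

instance : Fintype (SwitchQuiver T) where
  elems := ⟨([source, middle, target] : List (SwitchQuiver T)), by simp⟩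
  complete x := by cases x <;> simp

/-- The arrow from the source to the middle with label `a`. -/
def fst (a : T ⊕ T × T × T) : (source : SwitchQuiver T) ⟶ middle := Arrow.fst a

/-- The arrow from the middle to the target with label `c`. -/
def snd (c : Option T) : (middle : SwitchQuiver T) ⟶ target := Arrow.snd c

/-- The path of length two with the given labels. -/
def twoPath (a : T ⊕ T × T × T) (c : Option T) : Path (source : SwitchQuiver T) target :=
  (Path.nil.cons (fst a)).cons (snd c)

@[elab_as_elim]
theorem path_cases {motive : ∀ {x y : SwitchQuiver T}, Path x y → Prop}
    (nil : ∀ x : SwitchQuiver T, motive (Path.nil : Quiver.Path x x)) (fst : ∀ a, motive (fst a).toPath)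
    (snd : ∀ c, motive (snd c).toPath) (two : ∀ a c, motive (twoPath a c))
    {x y : SwitchQuiver T} (p : Path x y) : motive p := by
  rcases p with _ | ⟨p, a⟩
  · exact nil _
  rcases a with a | c
  · rcases p with _ | ⟨p, b⟩
    · exact fst a
    · rcases b
  · rcases p with _ | ⟨p, b⟩
    · exact snd c
    · rcases b with a | b
      rcases p with _ | ⟨p, b⟩
      · exact two a c
      · rcases b

theorem twoPath_injective {a a' : T ⊕ T × T × T} {c c' : Option T}
    (h : twoPath a c = twoPath a' c') : a = a' ∧ c = c' := by
  simp only [twoPath, Path.cons.injEq, heq_eq_eq, true_and] at h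
  exact ⟨Arrow.fst.inj h.1, Arrow.snd.inj h.2⟩

theorem isAcyclicQuiver : IsAcyclicQuiver (SwitchQuiver T) := by
  intro x p
  rcases p with _ | ⟨p, a⟩
  · rfl
  rcases a with a | c
  · rcases p with _ | ⟨p, b⟩
    rcases b
  · rcases p with _ | ⟨p, b⟩
    rcases b with a | b
    rcases p with _ | ⟨p, b⟩
    rcases b

theorem length_lt {x y : SwitchQuiver T} (p : Path x y) : p.length < 3 := by
  induction p using path_cases <;> simp [twoPath]

instance [Finite T] (x y : SwitchQuiver T) : Finite (x ⟶ y) := by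
  cases x <;> cases y
  case source.middle => exact Finite.of_surjective fst fun | Arrow.fst a => ⟨a, rfl⟩
  case middle.target => exact Finite.of_surjective snd fun | Arrow.snd c => ⟨c, rfl⟩
  all_goals exact @Finite.of_subsingleton _ ⟨fun a => by rcases a⟩

/-- The walk from the source to a vertex through the arrows with labels `e` and `none`. -/
def baseWalk (e : T) : ∀ x : Symmetrify (SwitchQuiver T), Walk (SwitchQuiver T) source x
  | source => Path.nil
  | middle => arrowWalk (fst (.inl e))
  | target => (arrowWalk (fst (.inl e))).comp (arrowWalk (snd none))

theorem isConnectedQuiver [Nonempty T] : IsConnectedQuiver (SwitchQuiver T) :=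
  ⟨⟨source⟩, fun x y => by
    let e := Classical.arbitrary T
    exact ⟨(baseWalk e x).reverse.comp (baseWalk e y)⟩⟩

end SwitchQuiver

open SwitchQuiver

/-! ## A matrix representation -/

/-- The indices of the matrices that represent the path algebra of `SwitchQuiver T`. -/
abbrev MatrixIndex (T : Type) : Type := Unit ⊕ (T ⊕ T × T × T) ⊕ (T × Option T)

namespace MatrixIndex

variable {T : Type}

/-- The vertex of the quiver to which an index belongs. -/
def vertex : MatrixIndex T → SwitchQuiver T
  | .inl _ => source
  | .inr (.inl _) => middle
  | .inr (.inr _) => target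

end MatrixIndex

section Representation

open Classical

variable {k : Type u} [Field k] {T : Type}

/-- The matrix of a stationary path. -/
def vertexMatrix (k : Type u) [Field k] (x : SwitchQuiver T) :
    Matrix (MatrixIndex T) (MatrixIndex T) k :=
  Matrix.diagonal fun i => if i.vertex = x then 1 else 0

/-- The row of the matrix of an arrow from the source to the middle. -/
def fstRow (ε : T × T × T → k) : (a a' : T ⊕ T × T × T) → k
  | .inl s, .inl s' => if s = s' then 1 else 0
  | .inl _, .inr _ => 0
  -- The only place where the parameter enters: the row of `h` is its own unit vector plus `ε h`
  -- times that of `gen h.1`.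
  | .inr h, .inl s' => if h.1 = s' then ε h else 0
  | .inr h, .inr h' => if h = h' then 1 else 0

/-- The block of the matrix of an arrow from the middle to the target. -/
def sndBlock (k : Type u) [Field k] (c : Option T) : (a : T ⊕ T × T × T) → T × Option T → k
  | .inl s, f => if (s, c) = f then 1 else 0
  -- For `h = (s, t, r)`, the unit vector of `h` is sent by `snd (some t)` to the basis vector of
  -- `gen r` followed by `snd none`, and by every other `snd c` to zero.
  | .inr h, f => if c = some h.2.1 ∧ (h.2.2, none) = f then 1 else 0

/-- The matrix of an arrow. The coefficient `ε h` adds a multiple of an ordinary arrow to the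
auxiliary arrow `h`. -/
def arrowMatrix (ε : T × T × T → k) {x y : SwitchQuiver T} :
    (x ⟶ y) → Matrix (MatrixIndex T) (MatrixIndex T) k
  | .fst a, .inl _, .inr (.inl a') => fstRow ε a a'
  | .snd c, .inr (.inl a), .inr (.inr f) => sndBlock k c a f
  | _, _, _ => 0

theorem vertex_eq_of_arrowMatrix_ne_zero (ε : T × T × T → k) {x y : SwitchQuiver T} (a : x ⟶ y)
    {i j : MatrixIndex T} (h : arrowMatrix ε a i j ≠ 0) : i.vertex = x ∧ j.vertex = y := by
  rcases a with a | c <;> rcases i with i | i | i <;> rcases j with j | j | j <;>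
    first
    | exact ⟨rfl, rfl⟩
    | exact absurd rfl h

variable [Fintype T]

theorem vertexMatrix_mul_arrowMatrix (ε : T × T × T → k) {x y : SwitchQuiver T} (a : x ⟶ y) :
    vertexMatrix k x * arrowMatrix ε a = arrowMatrix ε a := by
  ext i j
  rw [vertexMatrix, Matrix.diagonal_mul]
  by_cases h : arrowMatrix ε a i j = 0
  · rw [h, mul_zero]
  · rw [if_pos (vertex_eq_of_arrowMatrix_ne_zero ε a h).1, one_mul]

theorem arrowMatrix_mul_vertexMatrix (ε : T × T × T → k) {x y : SwitchQuiver T} (a : x ⟶ y) :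
    arrowMatrix ε a * vertexMatrix k y = arrowMatrix ε a := by
  ext i j
  rw [vertexMatrix, Matrix.mul_diagonal]
  by_cases h : arrowMatrix ε a i j = 0
  · rw [h, zero_mul]
  · rw [if_pos (vertex_eq_of_arrowMatrix_ne_zero ε a h).2, mul_one]

theorem completeOrthogonalIdempotents_vertexMatrix :
    CompleteOrthogonalIdempotents (vertexMatrix k (T := T)) where
  idem x := by
    rw [IsIdempotentElem]
    unfold vertexMatrix
    rw [Matrix.diagonal_mul_diagonal]
    congr 1
    funext i
    split_ifs <;> simp
  ortho x y hxy := by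
    change vertexMatrix k x * vertexMatrix k y = 0
    unfold vertexMatrix
    rw [Matrix.diagonal_mul_diagonal, ← Matrix.diagonal_zero]
    congr 1
    funext i
    split_ifs with h h'
    · exact absurd (h.symm.trans h') hxy
    all_goals simp
  complete := by
    ext i j
    rw [Matrix.sum_apply]
    rcases eq_or_ne i j with rfl | h
    · simp [vertexMatrix]
    · simp [vertexMatrix, h]

/-- The representation of the path algebra of `SwitchQuiver T` by matrices. -/
def matrixRep (ε : T × T × T → k) :
    PathAlgebra k (SwitchQuiver T) →ₐ[k] Matrix (MatrixIndex T) (MatrixIndex T) k :=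
  lift k (vertexMatrix k) (arrowMatrix ε) completeOrthogonalIdempotents_vertexMatrix
    (arrowMatrix_mul_vertexMatrix ε)

variable (ε : T × T × T → k)

theorem matrixRep_nil (x : SwitchQuiver T) :
    matrixRep ε (ofPath k (Path.nil : Path x x)) = vertexMatrix k x := by
  rw [matrixRep, lift_ofPath, pathImage]

theorem matrixRep_toPath {x y : SwitchQuiver T} (a : x ⟶ y) :
    matrixRep ε (ofPath k a.toPath) = arrowMatrix ε a := by
  rw [matrixRep, lift_ofPath, Hom.toPath, pathImage, pathImage, vertexMatrix_mul_arrowMatrix]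

theorem matrixRep_twoPath_apply (a : T ⊕ T × T × T) (c : Option T) (i j : MatrixIndex T) :
    matrixRep ε (ofPath k (twoPath a c)) i j =
      match i, j with
      | .inl _, .inr (.inr f) => ∑ a', fstRow ε a a' * sndBlock k c a' f
      | _, _ => 0 := by
  have h : matrixRep ε (ofPath k (twoPath a c)) =
      arrowMatrix ε (fst a) * arrowMatrix ε (snd c) := by
    rw [matrixRep, lift_ofPath, twoPath, pathImage, pathImage, pathImage,
      vertexMatrix_mul_arrowMatrix]
  rw [h, Matrix.mul_apply, Fintype.sum_sum_type, Fintype.sum_sum_type]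
  rcases i with i | i | i <;> rcases j with j | j | j <;> simp [arrowMatrix, fst, snd]

/-- Paths of length two through ordinary arrows give distinct unit vectors, hence stay linearly
independent in the algebra. -/
theorem matrixRep_twoPath_inl (s : T) (c : Option T) (f : T × Option T) :
    matrixRep ε (ofPath k (twoPath (.inl s) c)) (.inl ()) (.inr (.inr f)) =
      if (s, c) = f then 1 else 0 := by
  rw [matrixRep_twoPath_apply]
  simp only [Fintype.sum_sum_type, fstRow, sndBlock, ite_mul, one_mul, zero_mul]
  simp

/-- With `matrixRep_twoPath_inl` this encodes the relations: each path through an auxiliary arrow is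
a combination of paths through ordinary ones. -/
theorem matrixRep_twoPath_inr (h : T × T × T) (c : Option T) (f : T × Option T) :
    matrixRep ε (ofPath k (twoPath (.inr h) c)) (.inl ()) (.inr (.inr f)) =
      (if (h.1, c) = f then ε h else 0) +
        if c = some h.2.1 ∧ (h.2.2, none) = f then 1 else 0 := by
  rw [matrixRep_twoPath_apply]
  simp only [Fintype.sum_sum_type, fstRow, sndBlock, ite_mul, one_mul, zero_mul]
  simp

end Representation

end

end BoundQuiver

namespace BoundQuiver

open Quiver PathAlgebra

noncomputable section

open SwitchQuiver

section Representation

open Classical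

variable {k : Type u} [Field k] {T : Type}

/-! ## The kernel of the representation is admissible -/

theorem arrowIdeal_pow_three_eq_zero {a : PathAlgebra k (SwitchQuiver T)}
    (ha : a ∈ arrowIdeal k (SwitchQuiver T) ^ 3) : a = 0 := by
  have h := arrowIdeal_pow_le 3 ha
  rwa [lengthFiltration_eq_bot fun p => length_lt p, Submodule.mem_bot] at h

theorem ofPath_twoPath_mem (a : T ⊕ T × T × T) (c : Option T) :
    ofPath k (twoPath a c) ∈ arrowIdeal k (SwitchQuiver T) ^ 2 := by
  have h : ofPath k (twoPath a c) = ofPath k (fst a).toPath * ofPath k (snd c).toPath := by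
    rw [ofPath_mul_ofPath]; rfl
  rw [h, Submodule.pow_succ, Submodule.pow_one]
  exact Ideal.mul_mem_mul (ofPath_mem_arrowIdeal _) (ofPath_mem_arrowIdeal _)

variable [Fintype T] (ε : T × T × T → k)

/-- The element of the path algebra whose image under the representation is the elementary row
with label `a`. -/
def fstLift : T ⊕ T × T × T → PathAlgebra k (SwitchQuiver T)
  | .inl s => ofPath k (fst (.inl s)).toPath
  | .inr h => ofPath k (fst (.inr h)).toPath - ε h • ofPath k (fst (.inl h.1)).toPath

/-- A linear map that recovers the part of length at most one of an element of the path algebra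
from its matrix. -/
def lengthOnePart (e : T) :
    Matrix (MatrixIndex T) (MatrixIndex T) k →ₗ[k] PathAlgebra k (SwitchQuiver T) :=
  (Matrix.entryLinearMap k k (.inl ()) (.inl ())).smulRight
      (ofPath k (Path.nil : Quiver.Path (source : SwitchQuiver T) source)) +
    (Matrix.entryLinearMap k k (.inr (.inl (.inl e))) (.inr (.inl (.inl e)))).smulRight
      (ofPath k (Path.nil : Quiver.Path (middle : SwitchQuiver T) middle)) +
    (Matrix.entryLinearMap k k (.inr (.inr (e, none))) (.inr (.inr (e, none)))).smulRight
      (ofPath k (Path.nil : Quiver.Path (target : SwitchQuiver T) target)) +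
    ∑ a, (Matrix.entryLinearMap k k (.inl ()) (.inr (.inl a))).smulRight (fstLift ε a) +
    ∑ c, (Matrix.entryLinearMap k k (.inr (.inl (.inl e))) (.inr (.inr (e, c)))).smulRight
      (ofPath k (snd c).toPath)

/-- `lengthOnePart` undoes the representation on paths of length at most one and kills those of
length two. For `a` in the kernel the subtracted term vanishes, so the kernel lies in the square of
the arrow ideal. -/
theorem sub_lengthOnePart_mem (e : T) (a : PathAlgebra k (SwitchQuiver T)) :
    a - lengthOnePart ε e (matrixRep ε a) ∈ arrowIdeal k (SwitchQuiver T) ^ 2 := by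
  have ha := (pathBasis k (SwitchQuiver T)).mem_span a
  induction ha using Submodule.span_induction with
  | zero => rw [map_zero, map_zero, sub_zero]; exact Ideal.zero_mem _
  | add a b _ _ ha hb =>
    rw [map_add, map_add, add_sub_add_comm]
    exact Ideal.add_mem _ ha hb
  | smul c a _ ha =>
    rw [map_smul, map_smul, ← smul_sub, Algebra.smul_def]
    exact Ideal.mul_mem_left _ _ ha
  | mem a ha =>
    obtain ⟨⟨x, y, p⟩, rfl⟩ := ha
    change ofPath k p - lengthOnePart ε e (matrixRep ε (ofPath k p)) ∈ _
    have hzero : ∀ {q r : PathAlgebra k (SwitchQuiver T)}, q = r →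
        r - q ∈ arrowIdeal k (SwitchQuiver T) ^ 2 := fun h => by
      rw [h, sub_self]; exact Ideal.zero_mem _
    induction p using path_cases with
    | nil x =>
      refine hzero ?_
      rw [matrixRep_nil]
      cases x <;> simp [lengthOnePart, vertexMatrix, MatrixIndex.vertex]
    | fst a =>
      refine hzero ?_
      rw [matrixRep_toPath]
      rcases a with s | h <;>
        simp [lengthOnePart, arrowMatrix, fst, fstRow, fstLift, Fintype.sum_sum_type]
    | snd c =>
      refine hzero ?_
      rw [matrixRep_toPath]
      cases c <;> simp [lengthOnePart, arrowMatrix, snd, sndBlock]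
    | two a c =>
      have h : lengthOnePart ε e (matrixRep ε (ofPath k (twoPath a c))) = 0 := by
        simp [lengthOnePart, matrixRep_twoPath_apply]
      rw [h, sub_zero]
      exact ofPath_twoPath_mem a c

/-! ## The algebra -/

/-- All parameters give the same algebra of matrices: the matrices of an auxiliary arrow for two
parameters differ by a multiple of the matrix of an ordinary arrow. -/
theorem matrixRep_mem_range (ε' : T × T × T → k) (a : PathAlgebra k (SwitchQuiver T)) :
    matrixRep ε a ∈ (matrixRep ε').range := by
  refine lift_mem _ _ _ (fun x => (AlgHom.mem_range _).mpr ⟨_, matrixRep_nil ε' x⟩)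
    (fun {x y} a => (AlgHom.mem_range _).mpr ?_) a
  rcases a with (s | h) | c
  · refine ⟨_, (matrixRep_toPath ε' (fst (.inl s))).trans ?_⟩
    ext i j
    rcases i with i | i | i <;> rcases j with j | (j | j) | j <;> rfl
  · refine ⟨ofPath k (fst (.inr h)).toPath + (ε h - ε' h) • ofPath k (fst (.inl h.1)).toPath, ?_⟩
    change matrixRep ε' _ = _
    rw [map_add, map_smul, matrixRep_toPath, matrixRep_toPath]
    ext i j
    rcases i with i | i | i <;> rcases j with j | (j | j) | j <;>
      simp [arrowMatrix, fst, fstRow]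
    split_ifs <;> simp
  · refine ⟨_, (matrixRep_toPath ε' (snd c)).trans ?_⟩
    ext i j
    rcases i with i | i | i <;> rcases j with j | j | j <;> rfl

/-- The algebra of matrices that represent elements of the path algebra. -/
abbrev switchAlgebra (k : Type u) [Field k] (T : Type) [Fintype T] :
    Subalgebra k (Matrix (MatrixIndex T) (MatrixIndex T) k) :=
  (matrixRep (0 : T × T × T → k)).range

/-- The presentation of the algebra `switchAlgebra k T` given by the parameters `ε`. -/
def switchPresentation : PathAlgebra k (SwitchQuiver T) →ₐ[k] switchAlgebra k T :=
  (matrixRep ε).codRestrict _ (matrixRep_mem_range ε 0)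

theorem mem_ker_switchPresentation {a : PathAlgebra k (SwitchQuiver T)} :
    a ∈ RingHom.ker (switchPresentation ε) ↔ matrixRep ε a = 0 := by
  rw [RingHom.mem_ker, ← Subtype.coe_inj]
  rfl

theorem isPresentation_switchPresentation [Nonempty T] :
    IsPresentation (switchPresentation ε) where
  finite_arrows _ _ := inferInstance
  connected := isConnectedQuiver
  surjective := by
    rintro ⟨X, a, rfl⟩
    obtain ⟨b, hb⟩ := matrixRep_mem_range 0 ε a
    exact ⟨b, Subtype.ext hb⟩
  admissible :=
    { isTwoSided := inferInstance
      exists_pow_le := ⟨3, by norm_num, fun a ha => by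
        rw [arrowIdeal_pow_three_eq_zero ha]; exact Ideal.zero_mem _⟩
      le_sq := fun a ha => by
        have h := sub_lengthOnePart_mem ε (Classical.arbitrary T) a
        rwa [(mem_ker_switchPresentation ε).mp ha, map_zero, sub_zero] at h }

end Representation

/-! ## The fundamental group -/

section FundamentalGroup

open Classical

variable {T : Type} {G : Type v} [Group G] (σ : T → G)

/-- The weights of the arrows. -/
def arrowWeight {x y : SwitchQuiver T} : (x ⟶ y) → G
  | .fst (.inl s) => σ s
  -- Chosen so that, for `h = (s, t, r)`, the path `aux h`, `snd (some t)` has weight `σ r`, as does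
  -- `gen r`, `snd none`.
  | .fst (.inr h) => σ h.2.2 * (σ h.2.1)⁻¹
  | .snd none => 1
  | .snd (some t) => σ t

/-- The degrees of the rows and columns of matrices. -/
def indexDegree : MatrixIndex T → G
  | .inl _ => 1
  | .inr (.inl (.inl s)) => σ s
  | .inr (.inl (.inr h)) => σ h.2.2 * (σ h.2.1)⁻¹
  | .inr (.inr (s, none)) => σ s
  | .inr (.inr (s, some t)) => σ s * σ t

variable {k : Type u} [Field k] (ε : T × T × T → k)

/-- The matrices of arrows are homogeneous for the degrees of rows and columns. Only the entries `ε
(s, t, r)` need `hε`, which makes the weight of the auxiliary arrow equal to `σ s`. -/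
theorem indexDegree_eq_of_arrowMatrix_ne_zero
    (hε : ∀ s t r, ε (s, t, r) ≠ 0 → σ s * σ t = σ r) {x y : SwitchQuiver T} (a : x ⟶ y)
    {i j : MatrixIndex T} (h : arrowMatrix ε a i j ≠ 0) :
    indexDegree σ i * arrowWeight σ a = indexDegree σ j := by
  rcases a with (s | ⟨s, t, r⟩) | (_ | t) <;> rcases i with i | (i | i) | i <;>
    rcases j with j | (j | j) | ⟨j, _ | c⟩ <;>
    simp [arrowMatrix, fstRow, sndBlock] at h <;>
    simp_all [indexDegree, arrowWeight]
  · rw [← h.1, mul_inv_eq_iff_eq_mul, hε s t r h.2]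
  · rw [← h]

variable [Fintype T]

theorem indexDegree_eq_of_matrixRep_ne_zero
    (hε : ∀ s t r, ε (s, t, r) ≠ 0 → σ s * σ t = σ r) {x y : SwitchQuiver T} (p : Path x y)
    {i j : MatrixIndex T} (h : matrixRep ε (ofPath k p) i j ≠ 0) :
    indexDegree σ i * pathWeight (arrowWeight σ) p = indexDegree σ j := by
  rw [matrixRep, lift_ofPath] at h
  induction p generalizing j with
  | nil =>
    rw [pathImage, vertexMatrix, Matrix.diagonal_apply] at h
    have hij : i = j := by by_contra hij; exact h (if_neg hij)
    rw [hij, pathWeight, mul_one]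
  | cons p a ih =>
    rw [pathImage, Matrix.mul_apply] at h
    obtain ⟨l, _, hl⟩ := Finset.exists_ne_zero_of_sum_ne_zero h
    rw [pathWeight, ← mul_assoc, ih (left_ne_zero_of_mul hl),
      indexDegree_eq_of_arrowMatrix_ne_zero σ ε hε a (right_ne_zero_of_mul hl)]

/-- The matrix entries cut out the kernel, and by homogeneity each of them sees only paths of one
weight. -/
theorem pathWeight_eq_of_isMinimalRelation
    (hε : ∀ s t r, ε (s, t, r) ≠ 0 → σ s * σ t = σ r) {x y : SwitchQuiver T}
    {ρ : Path x y →₀ k} (hρ : IsMinimalRelation (RingHom.ker (switchPresentation ε)) ρ) :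
    ∀ p ∈ ρ.support, ∀ q ∈ ρ.support,
      pathWeight (arrowWeight σ) p = pathWeight (arrowWeight σ) q := by
  intro p hp q hq
  refine hρ.degree_eq (pathWeight (arrowWeight σ))
    (fun ij : MatrixIndex T × MatrixIndex T =>
      (Matrix.entryLinearMap k k ij.1 ij.2).comp (matrixRep ε).toLinearMap)
    (fun a => ?_) (fun ij p q hp hq => ?_) hp hq
  · rw [mem_ker_switchPresentation, ← Matrix.ext_iff, Prod.forall]
    rfl
  · exact mul_left_cancel ((indexDegree_eq_of_matrixRep_ne_zero σ ε hε p hp).trans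
      (indexDegree_eq_of_matrixRep_ne_zero σ ε hε q hq).symm)

/-- Both homotopies come from the relation `P - ε • S - R`, whose middle term is present exactly
when the parameter is nonzero. -/
theorem homotopic_twoPath (s t r : T) :
    Homotopic (RingHom.ker (switchPresentation ε)) (pathWalk (twoPath (.inr (s, t, r)) (some t)))
        (pathWalk (twoPath (.inl r) none)) ∧
      (ε (s, t, r) ≠ 0 → Homotopic (RingHom.ker (switchPresentation ε))
        (pathWalk (twoPath (.inr (s, t, r)) (some t)))
        (pathWalk (twoPath (.inl s) (some t)))) := by
  set P : Path (source : SwitchQuiver T) target := twoPath (.inr (s, t, r)) (some t) with hP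
  set S : Path (source : SwitchQuiver T) target := twoPath (.inl s) (some t) with hS
  set R : Path (source : SwitchQuiver T) target := twoPath (.inl r) none with hR
  have hPS : P ≠ S := fun h => by simpa using (twoPath_injective h).1
  have hPR : P ≠ R := fun h => by simpa using (twoPath_injective h).1
  have hSR : S ≠ R := fun h => by simpa using (twoPath_injective h).2
  let ρ : Path (source : SwitchQuiver T) target →₀ k :=
    Finsupp.single P 1 - Finsupp.single S (ε (s, t, r)) - Finsupp.single R 1
  have hρP : ρ P = 1 := by simp [ρ, hPS, hPR]
  have hρS : ρ S = - ε (s, t, r) := by simp [ρ, hPS.symm, hSR]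
  have hρR : ρ R = -1 := by simp [ρ, hPR.symm, hSR.symm]
  have hρ : ∀ q ∈ ρ.support, q = P ∨ q = S ∨ q = R := by
    intro q hq
    by_contra! h
    exact Finsupp.mem_support_iff.mp hq
      (by simp [ρ, h.1.symm, h.2.1.symm, h.2.2.symm])
  have hsum : ∑ p ∈ ρ.support, ρ p • ofPath k p =
      ofPath k P - ε (s, t, r) • ofPath k S - ofPath k R := by
    change Finsupp.linearCombination k (ofPath k) ρ = _
    simp [ρ]
  have hmem : ∑ p ∈ ρ.support, ρ p • ofPath k p ∈ RingHom.ker (switchPresentation ε) := by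
    rw [hsum, mem_ker_switchPresentation, map_sub, map_sub, map_smul]
    ext i j
    simp only [Matrix.sub_apply, Matrix.smul_apply, Matrix.zero_apply]
    rcases i with i | i | i <;> rcases j with j | j | j
    case inl.inr.inr =>
      rw [matrixRep_twoPath_inl, matrixRep_twoPath_inl, matrixRep_twoPath_inr]
      simp
    all_goals simp [hP, hS, hR, matrixRep_twoPath_apply]
  have hentry : ∀ f : T × Option T, ∀ a ∈ RingHom.ker (switchPresentation ε),
      (Matrix.entryLinearMap k k (.inl ()) (.inr (.inr f))).comp (matrixRep ε).toLinearMap a =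
        0 := by
    intro f a ha
    change matrixRep ε a _ _ = 0
    rw [(mem_ker_switchPresentation ε).mp ha]
    rfl
  have hlink := fun {q} hq => homotopic_of_linked hmem (p := P)
    (Finsupp.mem_support_iff.mpr (by rw [hρP]; exact one_ne_zero)) (fun q hq hqP => by
      rcases hρ q hq with rfl | rfl | rfl
      · exact absurd rfl hqP
      · have hε : ε (s, t, r) ≠ 0 := by
          rw [Finsupp.mem_support_iff, hρS] at hq
          exact neg_ne_zero.mp hq
        -- This entry links `P`, with value `ε (s, t, r)`, to `S`; it vanishes on `R`, which ends in
        -- `snd none`.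
        refine ⟨_, hentry (s, some t), ?_, ?_, fun q hq h h' => ?_⟩
        · change matrixRep ε _ _ _ ≠ 0
          rw [matrixRep_twoPath_inr]
          simpa using hε
        · change matrixRep ε _ _ _ ≠ 0
          rw [matrixRep_twoPath_inl]
          simp
        · obtain rfl : q = R := by have := hρ q hq; tauto
          change matrixRep ε _ _ _ = 0
          rw [matrixRep_twoPath_inl]
          simp
      -- This entry is 1 on both `P` and `R` and vanishes on `S`.
      · refine ⟨_, hentry (r, none), ?_, ?_, fun q hq h h' => ?_⟩
        · change matrixRep ε _ _ _ ≠ 0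
          rw [matrixRep_twoPath_inr]
          simp
        · change matrixRep ε _ _ _ ≠ 0
          rw [matrixRep_twoPath_inl]
          simp
        · obtain rfl : q = S := by have := hρ q hq; tauto
          change matrixRep ε _ _ _ = 0
          rw [matrixRep_twoPath_inl]
          simp) (q := q) hq
  refine ⟨hlink (Finsupp.mem_support_iff.mpr ?_), fun hε => hlink (Finsupp.mem_support_iff.mpr ?_)⟩
  · rw [hρR]
    exact neg_ne_zero.mpr one_ne_zero
  · rw [hρS]
    exact neg_ne_zero.mpr hε

theorem closedUp_arrowWalk_eq_one {V : Type v} [Quiver.{w} V] [Fintype V]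
    {I : Ideal (PathAlgebra k V)} {o : V} (τ : ∀ x : Symmetrify V, Walk V o x) {x y : V}
    (a : x ⟶ y) (h : τ y = (τ x).comp (arrowWalk a)) : closedUp I τ (arrowWalk a) = 1 := by
  refine Quotient.sound ?_
  rw [h]
  exact (Homotopic.comp_reverse I _).1

theorem nonempty_fundamentalGroup_switchPresentation_mulEquiv (hσ : IsProductPresentation σ)
    (hε : ∀ s t r, ε (s, t, r) ≠ 0 ↔ σ s * σ t = σ r) (x : SwitchQuiver T) :
    Nonempty (FundamentalGroup (RingHom.ker (switchPresentation ε)) x ≃* G) := by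
  obtain ⟨e, he⟩ := hσ.exists_eq_one
  set I := RingHom.ker (switchPresentation ε)
  let cl : ∀ {x y : SwitchQuiver T}, (x ⟶ y) → FundamentalGroup I source :=
    fun a => closedUp I (baseWalk e) (arrowWalk a)
  have htwo : ∀ a c, closedUp I (baseWalk e) (pathWalk (twoPath a c)) = cl (fst a) * cl (snd c) :=
    fun a c => closedUp_comp (baseWalk e) (arrowWalk (fst a)) (arrowWalk (snd c))
  have he1 : cl (fst (.inl e)) = 1 :=
    closedUp_arrowWalk_eq_one _ _ (Path.nil_comp _).symm
  have hnone : cl (snd none) = 1 := closedUp_arrowWalk_eq_one _ _ rfl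
  -- Valid for every parameter: the auxiliary arrows contribute no new generators.
  have haux : ∀ s t r, cl (fst (.inr (s, t, r))) * cl (snd (some t)) = cl (fst (.inl r)) := by
    intro s t r
    rw [← htwo, (closedUp_eq_iff _).mpr (homotopic_twoPath ε s t r).1, htwo, hnone, mul_one]
  have hmul : ∀ s t r, σ s * σ t = σ r →
      cl (fst (.inl s)) * cl (snd (some t)) = cl (fst (.inl r)) := by
    intro s t r h
    rw [← haux s t r, ← htwo, ← htwo,
      (closedUp_eq_iff _).mpr ((homotopic_twoPath ε s t r).2 ((hε s t r).mpr h))]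
  -- The product `σ e * σ t = σ t` identifies the two arrows labelled by `t`.
  have hsnd : ∀ t, cl (snd (some t)) = cl (fst (.inl t)) := by
    intro t
    rw [← hmul e t t (by rw [he, one_mul]), he1, one_mul]
  obtain ⟨φ, hφ⟩ := hσ.exists_hom (fun t => cl (fst (.inl t))) fun s t r h => by
    rw [← hsnd t, hmul s t r h]
  refine nonempty_fundamentalGroup_mulEquiv (arrowWeight σ) (baseWalk e)
    (fun hρ => pathWeight_eq_of_isMinimalRelation σ ε (fun s t r => (hε s t r).mp) hρ)
    ?_ (fun x => ?_) φ (fun {x y} a => ?_) x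
  · rw [eq_top_iff, ← hσ.closure_range]
    refine Subgroup.closure_mono ?_
    rintro _ ⟨t, rfl⟩
    exact ⟨_, _, fst (.inl t), rfl⟩
  · have h1 : walkWeight (arrowWeight σ) (arrowWalk (fst (.inl e))) = 1 :=
      (walkWeight_arrowWalk _ _).trans he
    cases x with
    | source => rfl
    | middle => exact h1
    | target =>
      exact (walkWeight_comp _ _ _).trans
        ((congrArg₂ (· * ·) h1 (walkWeight_arrowWalk _ _)).trans (one_mul _))
  · change φ (arrowWeight σ a) = cl a
    rcases a with (s | ⟨s, t, r⟩) | (_ | t)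
    · exact hφ s
    · change φ (σ r * (σ t)⁻¹) = cl (fst (.inr (s, t, r)))
      rw [map_mul, map_inv, hφ, hφ, ← haux s t r, ← hsnd, mul_inv_cancel_right]
    · exact (map_one φ).trans hnone.symm
    · exact (hφ t).trans (hsnd t).symm

/-- Finitely many groups with product presentations indexed by the same finite type are the
fundamental groups of presentations of one triangular algebra. -/
theorem exists_presentations (k : Type u) [Field k] (T : Type) [Finite T] [Nonempty T] {ι : Type*}
    (M : ι → Type v) [∀ i, Group (M i)] (σ : ∀ i, T → M i)
    (hσ : ∀ i, IsProductPresentation (σ i)) :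
    ∃ (A : Type u) (_ : Ring A) (_ : Algebra k A)
      (Q : Type) (_ : Quiver.{0} Q) (_ : Fintype Q) (ν : ι → (PathAlgebra k Q →ₐ[k] A)),
      IsTriangularAlgebra k A ∧ IsAcyclicQuiver Q ∧
      ∀ i, IsPresentation (ν i) ∧
        ∀ x : Q, Nonempty (FundamentalGroup (RingHom.ker (ν i)) x ≃* M i) := by
  have : Fintype T := Fintype.ofFinite T
  -- Switch on exactly the product relations that hold in `M i`.
  let ε : ι → T × T × T → k := fun i h => if σ i h.1 * σ i h.2.1 = σ i h.2.2 then 1 else 0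
  refine ⟨switchAlgebra k T, inferInstance, inferInstance, SwitchQuiver T, inferInstance,
    inferInstance, fun i => switchPresentation (ε i),
    ⟨_, _, _, _, isAcyclicQuiver, isPresentation_switchPresentation 0⟩, isAcyclicQuiver,
    fun i => ⟨isPresentation_switchPresentation (ε i), fun x => ?_⟩⟩
  refine nonempty_fundamentalGroup_switchPresentation_mulEquiv _ (ε i) (hσ i) (fun s t r => ?_) x
  simp [ε]

end FundamentalGroup

end

end BoundQuiver

/-! ### Conclusion over a common index set. -/

theorem mainTheorem3 (k : Type u) [Field k] [IsAlgClosed k] (n : ℕ) (M : Fin n → Type v)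
    [∀ i, CommGroup (M i)] [∀ i, Group.FG (M i)] :
    ∃ (A : Type u) (_ : Ring A) (_ : Algebra k A)
      (Q : Type) (_ : Quiver.{0} Q) (_ : Fintype Q)
      (ν : Fin n → (BoundQuiver.PathAlgebra k Q →ₐ[k] A)),
      BoundQuiver.IsTriangularAlgebra k A ∧
      BoundQuiver.IsAcyclicQuiver Q ∧
      ∀ i, BoundQuiver.IsPresentation (ν i) ∧
        ∀ x : Q, Nonempty (BoundQuiver.FundamentalGroup (RingHom.ker (ν i)) x ≃* M i) := by
  choose T hT σ hσ using fun i => BoundQuiver.exists_isProductPresentation (M i)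
  have : ∀ i, Nonempty (T i) := fun i => (hσ i).exists_eq_one.nonempty
  -- The product of the index sets serves all groups at once; its projections are surjective because
  -- every factor is nonempty.
  exact BoundQuiver.exists_presentations k (∀ i, T i) M (fun i t => σ i (t i))
    fun i => (hσ i).comp_surjective (Function.surjective_eval i)
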